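/- Let $\mathbb R^{2n}$, $n\ge 1$, carry the coordinates $(x_1,y_1,\dots,x_n,y_n)$, its Euclidean structure and the symplectic form $\omega=\sum_j dx_j\wedge dy_j$. Let $B^{2n}$ be the open Euclidean unit ball and $Z^{2n}(r)=\{x_1^2+y_1^2<r^2\}$. For $U\subset\mathbb R^{2n}$ put $$c^Z_{lin}(U)=\inf\{\pi r^2 : r>0,\ \psi(U)\subset Z^{2n}(r)\text{ for some linear symplectic }\psi\}.$$ A symplectic capacity $c$ assigns to each $U\subset\mathbb R^{2n}$ a value $c(U)\in[0,\infty]$ such that $c(U)\le c(V)$ if $U\subset V$; $c(\psi(U))=|\alpha|\,c(U)$ for every diffeomorphism $\psi$ of $\mathbb R^{2n}$ with $\psi^*\omega=\alpha\omega$; and $c(rB^{2n})=c(Z^{2n}(r))=\pi r^2$ for $r>0$. In particular $c(B^{2n})=\pi$. For a real normed space $X$ and $m\ge 0$, equip $\{-1,1\}^m$ with the uniform probability measure $\mu$, let $r_i(t)=t_i$, and let $\mathcal R_m f=\sum_{i=1}^m\big(\int f r_i\,d\mu\big) r_i$ for $f\in L^2(\{-1,1\}^m,X)$. The Rademacher projection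 constant (K-convexity constant) of $X$ is $\|\mathrm{Rad}\|_X=\sup_m\|\mathcal R_m\|$, where $\|\mathcal R_m\|$ is the operator norm on $L^2(\{-1,1\}^m,X)$. A convex body is a bounded convex set with non-empty interior. For a convex body $K\subset\mathbb R^{2n}$ let $X_K$ be $\mathbb R^{2n}$ normed by the Minkowski functional of $\tfrac12(K-K)$; if $K=-K$, then $\tfrac12(K-K)=K$, so $X_K$ is the normed space with unit ball $K$. **Theorem.** There is a universal constant $A_2>0$ such that for every $n\ge 1$ and every convex body $K\subset\mathbb R^{2n}$ with the origin in its interior $$\frac{c^Z_{lin}(K)}{\pi}\le A_2\,\|\mathrm{Rad}\|_{X_K}^2\Big(\frac{\mathrm{Vol}\,K}{\mathrm{Vol}\,B^{2n}}\Big)^{1/n},$$ and the same bound holds for $c^Z_{lin}(K)/c(B^{2n})$ for every symplectic capacity $c$. -/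

import Mathlib

open scoped ENNReal NNReal Pointwise ContDiff

noncomputable section

/-! ### Standard symplectic space -/

/-- `ℝ²ⁿ` with its Euclidean structure; the coordinate `x_j` of a point `z` is `z (Sum.inl j)`
and its coordinate `y_j` is `z (Sum.inr j)`. -/
abbrev PhaseSpace (n : ℕ) : Type := EuclideanSpace ℝ (Fin n ⊕ Fin n)

/-- The standard symplectic form `∑ dx_j ∧ dy_j`. -/
def stdSymplecticForm {n : ℕ} (u v : PhaseSpace n) : ℝ :=
  ∑ j : Fin n, (u (Sum.inl j) * v (Sum.inr j) - u (Sum.inr j) * v (Sum.inl j))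

/-- Membership in the group `Sp(ℝ²ⁿ)` of linear symplectic transformations. -/
def IsLinearSymplectic {n : ℕ} (ψ : PhaseSpace n ≃ₗ[ℝ] PhaseSpace n) : Prop :=
  ∀ u v, stdSymplecticForm (ψ u) (ψ v) = stdSymplecticForm u v

/-- The open symplectic cylinder `B²(r) × ℂⁿ⁻¹`. -/
def symplecticCylinder (n : ℕ) [NeZero n] (r : ℝ) : Set (PhaseSpace n) :=
  {z | z (Sum.inl 0) ^ 2 + z (Sum.inr 0) ^ 2 < r ^ 2}

/-- The linearized cylindrical capacity: the infimum (in `[0, ∞]`) of `π r²` over all `r > 0`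
such that some linear symplectic transformation maps `U` into the cylinder of radius `r`. -/
def linCylindricalCapacity {n : ℕ} [NeZero n] (U : Set (PhaseSpace n)) : ℝ≥0∞ :=
  ⨅ (r : ℝ) (_ : 0 < r) (ψ : PhaseSpace n ≃ₗ[ℝ] PhaseSpace n) (_ : IsLinearSymplectic ψ)
    (_ : ψ '' U ⊆ symplecticCylinder n r), ENNReal.ofReal (Real.pi * r ^ 2)

/-- Symplectic capacities on subsets of `ℝ²ⁿ`: monotonicity, conformality under diffeomorphisms
`ψ` with `ψ^* ω = α ω`, and normalization. The value `∞` is allowed. -/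
structure IsSymplecticCapacity {n : ℕ} [NeZero n] (c : Set (PhaseSpace n) → ℝ≥0∞) : Prop where
  mono : ∀ U V : Set (PhaseSpace n), U ⊆ V → c U ≤ c V
  conformal : ∀ (ψ : PhaseSpace n ≃ PhaseSpace n) (α : ℝ),
    ContDiff ℝ ∞ ψ → ContDiff ℝ ∞ ψ.symm →
    (∀ z u v, stdSymplecticForm (fderiv ℝ ψ z u) (fderiv ℝ ψ z v) = α * stdSymplecticForm u v) →
    ∀ U : Set (PhaseSpace n), c (ψ '' U) = ENNReal.ofReal |α| * c U
  ball : ∀ r : ℝ, 0 < r → c (Metric.ball 0 r) = ENNReal.ofReal (Real.pi * r ^ 2)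
  cylinder : ∀ r : ℝ, 0 < r → c (symplecticCylinder n r) = ENNReal.ofReal (Real.pi * r ^ 2)

/-! ### The Rademacher projection constant of a normed space -/

section Rademacher

variable {X : Type*} [NormedAddCommGroup X] [NormedSpace ℝ X]

/-- The Rademacher function `r_i(t) = t_i` on the discrete cube `{-1, 1}^m`, which is realized
as `Fin m → ℤˣ`. -/
def rademacher {m : ℕ} (i : Fin m) (t : Fin m → ℤˣ) : ℝ := ((t i : ℤ) : ℝ)

/-- The norm of `L²({-1, 1}^m, X)` for the uniform probability measure. -/
def cubeL2Norm {m : ℕ} (f : (Fin m → ℤˣ) → X) : ℝ :=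
  Real.sqrt ((1 / 2 ^ m : ℝ) * ∑ t, ‖f t‖ ^ 2)

/-- The first order Walsh coefficient `∫ f r_i dμ`. -/
def rademacherCoeff {m : ℕ} (f : (Fin m → ℤˣ) → X) (i : Fin m) : X :=
  (1 / 2 ^ m : ℝ) • ∑ t, rademacher i t • f t

/-- The Rademacher projection `R_m f = ∑ i, (∫ f r_i dμ) r_i`. -/
def rademacherProj {m : ℕ} (f : (Fin m → ℤˣ) → X) : (Fin m → ℤˣ) → X :=
  fun t => ∑ i : Fin m, rademacher i t • rademacherCoeff f i

variable (X) in
/-- The operator norm of the Rademacher projection `R_m` on `L²({-1, 1}^m, X)`. -/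
def rademacherProjNorm (m : ℕ) : ℝ≥0∞ :=
  ⨅ (C : ℝ≥0) (_ : ∀ f : (Fin m → ℤˣ) → X, cubeL2Norm (rademacherProj f) ≤ C * cubeL2Norm f),
    (C : ℝ≥0∞)

variable (X) in
/-- The Rademacher projection constant (K-convexity constant) `‖Rad‖_X = sup_m ‖R_m‖`,
as an element of `[0, ∞]`. -/
def radConst : ℝ≥0∞ := ⨆ m : ℕ, rademacherProjNorm X m

end Rademacher

/-! ### Convex bodies and their normed spaces -/

/-- Convex bodies: convex bounded sets with non-empty interior. -/
structure IsConvexBody {n : ℕ} (K : Set (PhaseSpace n)) : Prop where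
  convex : Convex ℝ K
  bounded : Bornology.IsBounded K
  interior_nonempty : (interior K).Nonempty

/-- The centrally symmetric body `½ (K - K)`, half of the difference body of `K`. -/
def symmetrization {n : ℕ} (K : Set (PhaseSpace n)) : Set (PhaseSpace n) :=
  (2⁻¹ : ℝ) • (K - K)

/-- A centrally symmetric convex set is its own symmetrization. -/
theorem symmetrization_eq_self {n : ℕ} {K : Set (PhaseSpace n)} (hK : Convex ℝ K)
    (hs : -K = K) : symmetrization K = K := by
  have h : K - K = (1 : ℝ) • K + (1 : ℝ) • K := by
    rw [sub_eq_add_neg, hs, one_smul]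
  rw [symmetrization, h, ← hK.add_smul zero_le_one zero_le_one, smul_smul]
  norm_num

theorem neg_symmetrization {n : ℕ} (K : Set (PhaseSpace n)) :
    -symmetrization K = symmetrization K := by
  ext x
  rw [Set.mem_neg, symmetrization, Set.mem_smul_set_iff_inv_smul_mem₀ (by norm_num),
    Set.mem_smul_set_iff_inv_smul_mem₀ (by norm_num), smul_neg, ← Set.mem_neg, neg_sub]

namespace IsConvexBody

variable {n : ℕ} {K : Set (PhaseSpace n)}

theorem symmetrization_convex (hK : IsConvexBody K) : Convex ℝ (symmetrization K) :=
  (hK.convex.sub hK.convex).smul _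

theorem symmetrization_bounded (hK : IsConvexBody K) :
    Bornology.IsBounded (symmetrization K) :=
  (hK.bounded.sub hK.bounded).smul₀ _

theorem symmetrization_mem_nhds (hK : IsConvexBody K) :
    symmetrization K ∈ nhds (0 : PhaseSpace n) := by
  obtain ⟨x, hx⟩ := hK.interior_nonempty
  have h1 : K - K ∈ nhds (0 : PhaseSpace n) := by
    have hopen : IsOpen (interior K - K) := isOpen_interior.sub_right
    exact Filter.mem_of_superset
      (hopen.mem_nhds ⟨x, hx, x, interior_subset hx, sub_self x⟩)
      (Set.sub_subset_sub_right interior_subset)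
  simpa [symmetrization] using
    (set_smul_mem_nhds_zero_iff (inv_ne_zero (two_ne_zero' ℝ))).2 h1

end IsConvexBody

/-- The normed space `X_K`: the vector space `ℝ²ⁿ` with the norm whose unit ball is `½ (K - K)`.
If `K` is centrally symmetric then `½ (K - K) = K`, so `X_K` is the space with unit ball `K`. -/
def BodySpace {n : ℕ} {K : Set (PhaseSpace n)} (_hK : IsConvexBody K) : Type := PhaseSpace n

namespace BodySpace

variable {n : ℕ} {K : Set (PhaseSpace n)} (hK : IsConvexBody K)

instance instAddCommGroup : AddCommGroup (BodySpace hK) :=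
  inferInstanceAs (AddCommGroup (PhaseSpace n))

instance instModule : Module ℝ (BodySpace hK) :=
  inferInstanceAs (Module ℝ (PhaseSpace n))

/-- The Minkowski functional of `½ (K - K)`. -/
instance instNorm : Norm (BodySpace hK) where
  norm x := gauge (symmetrization K) (show PhaseSpace n from x)

theorem core : NormedSpace.Core ℝ (BodySpace hK) where
  norm_nonneg x := gauge_nonneg (show PhaseSpace n from x)
  norm_smul a x := by
    have hsymm : ∀ y ∈ symmetrization K, -y ∈ symmetrization K := by
      intro y hy
      rw [← neg_symmetrization K]
      simpa using hy
    exact gauge_smul (𝕜 := ℝ) (s := symmetrization K)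
      ((balanced_iff_neg_mem hK.symmetrization_convex).2 hsymm) a (show PhaseSpace n from x)
  norm_triangle x y := gauge_add_le hK.symmetrization_convex
    (absorbent_nhds_zero hK.symmetrization_mem_nhds)
    (show PhaseSpace n from x) (show PhaseSpace n from y)
  norm_eq_zero_iff x := gauge_eq_zero (absorbent_nhds_zero hK.symmetrization_mem_nhds)
    ((NormedSpace.isVonNBounded_iff ℝ).2 hK.symmetrization_bounded)

instance instNormedAddCommGroup : NormedAddCommGroup (BodySpace hK) :=
  NormedAddCommGroup.ofCore (core hK)

instance instNormedSpace : NormedSpace ℝ (BodySpace hK) :=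
  NormedSpace.ofCore (core hK)

/-- For a centrally symmetric body `K`, the norm of `X_K` is the Minkowski functional of `K`. -/
theorem norm_eq_gauge_of_symmetric (hs : -K = K) (x : BodySpace hK) :
    ‖x‖ = gauge K (show PhaseSpace n from x) := by
  change gauge (symmetrization K) _ = _
  rw [symmetrization_eq_self hK.convex hs]

end BodySpace

end

/-! Let X = X_K, and measure a covector ω(a, ·) by its norm ‖a‖_* in X^*. If some pair satisfies
ω(a, b) > s‖a‖_*‖b‖_*, rescaling makes it a symplectic pair with both dual norms below s^(-1/2).
Completing it to linear symplectic coordinates squeezes K ⊂ 2·½(K − K) into a cylinder of radius²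
8/s (`linCylindricalCapacity_le`). It remains to show that such a pair exists for s of order
1/(R²ρ), where R = ‖Rad‖_X and ρ is the volume ratio to the power 1/n.

Otherwise the map X^* → X given by ω has norm at most s. Lewis' theorem
(`exists_basis_sum_coord_le`) gives a basis of X with Rademacher average at most 1 that is extremal
for the determinant; K-convexity then bounds the average of the dual basis by 2nR
(`sum_norm_signSum_coord_sq_le`). Transporting the dual basis to X by ω costs a factor s. A tuple of
small Rademacher average forces the unit ball to be large (`abs_det_le_volume_norm_le_one`), and the
determinants of the two ω-biorthogonal tuples are inverse to each other. Multiplying the two volume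
bounds gives 1 ≤ 4(2nsR)^(2n) Vol(½(K − K))² (`one_le_volume_sq_of_stdSymplecticBilin_le`).
Rogers–Shephard and n^n ≤ e^n n! contradict this for the chosen s. -/

noncomputable section

/-! ### Lewis' theorem by maximizing a determinant -/

/-- A function that is nonnegative to the right of a zero has nonnegative derivative there. -/
theorem HasDerivAt.nonneg_of_nonneg_right {g : ℝ → ℝ} {g' : ℝ} (hg : HasDerivAt g g' 0)
    (h0 : g 0 = 0) (h : ∀ t, 0 < t → 0 ≤ g t) : 0 ≤ g' := by
  refine ge_of_tendsto hg.tendsto_slope_zero_right ?_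
  filter_upwards [self_mem_nhdsWithin] with t ht
  simp only [zero_add, h0, sub_zero, smul_eq_mul]
  exact mul_nonneg (inv_nonneg.2 (le_of_lt ht)) (h t ht)

/-- Both sides of the hypothesis equal 1 at t = 0, so their right derivatives there compare; the
determinant has derivative tr A, and `q` collects its terms of order at least two. -/
theorem Matrix.trace_le_of_abs_det_one_add_smul_le {κ : Type*} [Fintype κ] [DecidableEq κ]
    (A : Matrix κ κ ℝ) (c : ℝ)
    (h : ∀ t : ℝ, 0 < t → |(1 + t • A).det| ≤ (1 + t * c) ^ Fintype.card κ) :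
    A.trace ≤ Fintype.card κ * c := by
  set q := ((1 + (Polynomial.X : Polynomial ℝ) • A.map Polynomial.C).det.divX.divX) with hq
  have hd : HasDerivAt
      (fun t : ℝ => (1 + t * c) ^ Fintype.card κ - (1 + A.trace * t + q.eval t * t ^ 2))
      (Fintype.card κ * c - A.trace) 0 := by
    have h1 : HasDerivAt (fun t : ℝ => (1 + t * c) ^ Fintype.card κ) (Fintype.card κ * c) 0 := by
      have := (((hasDerivAt_id (0 : ℝ)).mul_const c).const_add 1).fun_pow (Fintype.card κ)
      simpa using this
    have h2 : HasDerivAt (fun t : ℝ => 1 + A.trace * t + q.eval t * t ^ 2) A.trace 0 := by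
      have := ((((hasDerivAt_id (0 : ℝ)).const_mul A.trace).const_add 1)).fun_add
        ((q.hasDerivAt 0).fun_mul ((hasDerivAt_id (0 : ℝ)).fun_pow 2))
      simpa using this
    exact h1.sub h2
  have := hd.nonneg_of_nonneg_right (by simp) fun t ht => by
    have := (le_abs_self _).trans (h t ht)
    rw [Matrix.det_one_add_smul] at this
    simpa using this
  linarith

/-- Lewis' theorem: a basis of maximal determinant for a norm on `κ`-tuples is dual to itself
up to the factor `card κ`. -/
theorem exists_basis_sum_coord_le {κ X W : Type*} [Fintype κ] [DecidableEq κ] [Nonempty κ]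
    [NormedAddCommGroup X] [NormedSpace ℝ X] [NormedAddCommGroup W] [NormedSpace ℝ W]
    [FiniteDimensional ℝ W] (b : Module.Basis κ ℝ X) (Φ : (κ → X) →ₗ[ℝ] W)
    (hΦ : Function.Injective Φ) :
    ∃ x : Module.Basis κ ℝ X, ‖Φ x‖ ≤ 1 ∧
      ∀ v : κ → X, ∑ k, x.coord k (v k) ≤ Fintype.card κ * ‖Φ v‖ := by
  have : FiniteDimensional ℝ X := b.finiteDimensional_of_finite
  have hemb := LinearMap.isClosedEmbedding_of_injective (LinearMap.ker_eq_bot.2 hΦ)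
  have : ProperSpace W := FiniteDimensional.proper ℝ W
  have hcomp : IsCompact (Φ ⁻¹' Metric.closedBall 0 1) :=
    hemb.isCompact_preimage (isCompact_closedBall 0 1)
  have hcont : Continuous fun y : κ → X => |b.det y| := by
    refine continuous_abs.comp ?_
    have : (fun y : κ → X => b.det y) = fun y => (b.toMatrix y).det :=
      funext fun y => b.det_apply y
    rw [show (b.det : (κ → X) → ℝ) = fun y => (b.toMatrix y).det from this]
    refine Continuous.matrix_det (continuous_matrix fun i j => ?_)
    exact (b.coord i).continuous_of_finiteDimensional.comp (continuous_apply j)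
  obtain ⟨x₀, hx₀, hmax⟩ := hcomp.exists_isMaxOn ⟨0, by simp⟩ hcont.continuousOn
  have hscale : ∀ (c : ℝ) (y : κ → X), b.det (c • y) = c ^ Fintype.card κ * b.det y := by
    intro c y
    have := b.det.toMultilinearMap.map_smul_univ (fun _ => c) y
    rwa [Finset.prod_const, Finset.card_univ, smul_eq_mul] at this
  have hkey : ∀ y, |b.det y| ≤ |b.det x₀| * ‖Φ y‖ ^ Fintype.card κ := by
    intro y
    rcases eq_or_ne y 0 with rfl | hy
    · have h0 : b.det (0 : κ → X) = 0 := b.det.map_zero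
      rw [h0, abs_zero]; positivity
    · have hpos : 0 < ‖Φ y‖ := norm_pos_iff.2 fun h => hy (hΦ (by simpa using h))
      have hmem : ‖Φ y‖⁻¹ • y ∈ Φ ⁻¹' Metric.closedBall 0 1 := by
        simp [norm_smul, hpos.ne']
      have h1 := hmax hmem
      simp only [Set.mem_ofPred_eq, hscale, abs_mul, abs_pow, abs_inv, abs_norm, inv_pow] at h1
      rwa [inv_mul_le_iff₀ (by positivity), mul_comm] at h1
  -- The reference basis has determinant 1, so the maximum cannot be 0.
  have hdet : b.det x₀ ≠ 0 := by
    intro h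
    have := hkey b
    simp only [h, b.det_self] at this
    norm_num at this
  obtain ⟨hli, hsp⟩ := (Module.Basis.is_basis_iff_det b).2 (isUnit_iff_ne_zero.2 hdet)
  set x : Module.Basis κ ℝ X := Module.Basis.mk hli hsp.ge with hx
  have hxc : (x : κ → X) = x₀ := Module.Basis.coe_mk _ _
  have hx1 : ‖Φ x‖ ≤ 1 := by simpa [hxc] using hx₀
  refine ⟨x, hx1, fun v => ?_⟩
  -- First variation at the maximizer: replacing x by x + tv multiplies the determinant by det(1 +
  -- tA), where A expresses v in the basis x and tr A is the sum to be bounded. Maximality bounds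
  -- this factor by ‖Φ(x + tv)‖^N ≤ (1 + t‖Φ v‖)^N, with N = card κ.
  have := Matrix.trace_le_of_abs_det_one_add_smul_le (x.toMatrix v) ‖Φ v‖ fun t ht => ?_
  · simpa [Matrix.trace, Module.Basis.toMatrix_apply] using this
  · have hmat : 1 + t • x.toMatrix v = x.toMatrix ((x : κ → X) + t • v) := by
      ext i j
      simp [Module.Basis.toMatrix_apply, Matrix.one_apply, Finsupp.single_apply, eq_comm]
    have hprod : b.det ((x : κ → X) + t • v)
        = b.det x * (x.toMatrix ((x : κ → X) + t • v)).det := by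
      rw [Module.Basis.det_apply, Module.Basis.det_apply, ← Matrix.det_mul,
        Module.Basis.toMatrix_mul_toMatrix]
    have h1 := hkey ((x : κ → X) + t • v)
    rw [hprod, abs_mul, hxc, mul_le_mul_iff_of_pos_left (abs_pos.2 hdet), ← hxc, ← hmat] at h1
    refine h1.trans (pow_le_pow_left₀ (norm_nonneg _) ?_ _)
    rw [map_add, map_smul]
    refine (norm_add_le _ _).trans ?_
    rw [norm_smul, Real.norm_of_nonneg ht.le]
    linarith

/-! ### Rademacher sums, duality and contraction -/

/-- The Rademacher sum `∑ ε_k x_k`. -/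
def signSum {κ X : Type*} [Fintype κ] [AddCommGroup X] [Module ℝ X] (x : κ → X) (ε : κ → ℤˣ) : X :=
  ∑ k, ((ε k : ℤ) : ℝ) • x k

theorem map_signSum {κ X Y F : Type*} [Fintype κ] [AddCommGroup X] [Module ℝ X] [AddCommGroup Y]
    [Module ℝ Y] [FunLike F X Y] [LinearMapClass F ℝ X Y] (T : F) (x : κ → X) (ε : κ → ℤˣ) :
    T (signSum x ε) = signSum (fun k => T (x k)) ε := by
  simp [signSum, map_sum, map_smul]

theorem sum_sign_mul_sign {κ : Type*} [Fintype κ] [DecidableEq κ] (i j : κ) :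
    ∑ ε : κ → ℤˣ, ((ε i : ℤ) : ℝ) * ((ε j : ℤ) : ℝ) = if i = j then 2 ^ Fintype.card κ else 0 := by
  split_ifs with h
  · subst h
    have : ∀ u : ℤˣ, ((u : ℤ) : ℝ) * ((u : ℤ) : ℝ) = 1 := by
      intro u; rcases Int.units_eq_one_or u with rfl | rfl <;> norm_num
    simp [this]
  -- Flipping the i-th sign permutes the cube and negates the sum.
  · set d : κ → ℤˣ := Function.update 1 i (-1)
    have h1 : ∑ ε : κ → ℤˣ, ((ε i : ℤ) : ℝ) * ((ε j : ℤ) : ℝ)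
        = ∑ ε : κ → ℤˣ, (((d * ε) i : ℤ) : ℝ) * (((d * ε) j : ℤ) : ℝ) :=
      (Equiv.sum_comp (Equiv.mulLeft d)
        (fun ε : κ → ℤˣ => ((ε i : ℤ) : ℝ) * ((ε j : ℤ) : ℝ))).symm
    have h2 : d j = 1 := by simp [d, Function.update_of_ne (Ne.symm h)]
    have h3 : d i = -1 := by simp [d]
    simp only [Pi.mul_apply, h2, h3, Units.val_mul, Units.val_neg, Units.val_one] at h1
    simp only [neg_mul, one_mul, Int.cast_neg, Finset.sum_neg_distrib] at h1
    linarith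

theorem sum_sign_smul_signSum {κ X : Type*} [Fintype κ] [DecidableEq κ] [AddCommGroup X]
    [Module ℝ X] (x : κ → X) (k : κ) :
    ∑ ε : κ → ℤˣ, ((ε k : ℤ) : ℝ) • signSum x ε = (2 ^ Fintype.card κ : ℝ) • x k := by
  simp only [signSum, Finset.smul_sum, smul_smul]
  rw [Finset.sum_comm]
  simp only [← Finset.sum_smul, sum_sign_mul_sign]
  simp

/-- The map sending a tuple to its Rademacher sum, as an element of the (unnormalized) `L²` space
of the cube. -/
def signSumL2 (κ X : Type*) [Fintype κ] [NormedAddCommGroup X] [NormedSpace ℝ X] :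
    (κ → X) →ₗ[ℝ] PiLp 2 (fun _ : κ → ℤˣ => X) where
  toFun x := WithLp.toLp 2 (signSum x)
  map_add' x y := by ext ε; simp [signSum, Finset.sum_add_distrib]
  map_smul' c x := by ext ε; simp [signSum, Finset.smul_sum, smul_comm c]

theorem norm_signSumL2_sq {κ X : Type*} [Fintype κ] [DecidableEq κ] [NormedAddCommGroup X] [NormedSpace ℝ X]
    (x : κ → X) : ‖signSumL2 κ X x‖ ^ 2 = ∑ ε, ‖signSum x ε‖ ^ 2 := by
  rw [PiLp.norm_sq_eq_of_L2]; rfl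

theorem signSumL2_injective (κ X : Type*) [Fintype κ] [NormedAddCommGroup X]
    [NormedSpace ℝ X] : Function.Injective (signSumL2 κ X) := by
  classical
  intro x y hxy
  have h : ∀ ε, signSum x ε = signSum y ε := fun ε =>
    congrFun (congrArg WithLp.ofLp hxy) ε
  ext k
  have := sum_sign_smul_signSum x k
  simp only [h, sum_sign_smul_signSum] at this
  exact (smul_right_injective X (by positivity : (2 ^ Fintype.card κ : ℝ) ≠ 0) this).symm

/-- By compactness the functional attains its norm on the unit ball; the maximizer is rescaled by
‖ψ‖. -/
theorem exists_norm_eq_apply_eq_sq {X : Type*} [NormedAddCommGroup X] [NormedSpace ℝ X]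
    [FiniteDimensional ℝ X] (ψ : X →L[ℝ] ℝ) : ∃ f : X, ‖f‖ ≤ ‖ψ‖ ∧ ψ f = ‖ψ‖ ^ 2 := by
  have : ProperSpace X := FiniteDimensional.proper ℝ X
  obtain ⟨u, hu, hmax⟩ := (isCompact_closedBall (0 : X) 1).exists_isMaxOn ⟨0, by simp⟩
    (ψ.continuous.continuousOn)
  have hu1 : ‖u‖ ≤ 1 := by simpa using hu
  have hle : ‖ψ‖ ≤ ψ u := by
    refine ψ.opNorm_le_of_unit_norm ?_ fun z hz => ?_
    · simpa using hmax (show (0 : X) ∈ Metric.closedBall 0 1 by simp)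
    · rw [Real.norm_eq_abs]
      refine abs_le'.2 ⟨hmax (by simp [hz]), ?_⟩
      rw [← map_neg]
      exact hmax (by simp [hz])
  have hge : ψ u ≤ ‖ψ‖ := (le_abs_self _).trans <| by
    simpa using ψ.le_opNorm_of_le hu1
  refine ⟨‖ψ‖ • u, ?_, ?_⟩
  · rw [norm_smul, norm_norm]
    exact mul_le_of_le_one_right (norm_nonneg _) hu1
  · rw [map_smul, le_antisymm hge hle, smul_eq_mul, sq]

/-- Duality between the Rademacher averages of a Lewis basis and of its dual basis, in terms of a
bound `R` for the norm of the Rademacher projection. -/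
theorem sum_norm_signSum_coord_sq_le {κ X : Type*} [Fintype κ] [DecidableEq κ] [NormedAddCommGroup X]
    [NormedSpace ℝ X] [FiniteDimensional ℝ X] (x : Module.Basis κ ℝ X) {R N : ℝ} (hR0 : 0 ≤ R)
    (hN : 0 ≤ N) (hx : ∀ v : κ → X, ∑ k, x.coord k (v k) ≤ N * ‖signSumL2 κ X v‖)
    (hR : ∀ f : (κ → ℤˣ) → X, ∑ ε, ‖signSum (fun k => (1 / 2 ^ Fintype.card κ : ℝ) •
      ∑ t, ((t k : ℤ) : ℝ) • f t) ε‖ ^ 2 ≤ R ^ 2 * ∑ ε, ‖f ε‖ ^ 2) :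
    ∑ ε, ‖signSum (fun k => LinearMap.toContinuousLinearMap (x.coord k)) ε‖ ^ 2
      ≤ (2 ^ Fintype.card κ * N * R) ^ 2 := by
  set ψ : (κ → ℤˣ) → (X →L[ℝ] ℝ) :=
    signSum (fun k => LinearMap.toContinuousLinearMap (x.coord k)) with hψ
  choose f hf1 hf2 using fun ε => exists_norm_eq_apply_eq_sq (ψ ε)
  set M : ℝ := 2 ^ Fintype.card κ with hM
  have hMpos : 0 < M := by positivity
  set v : κ → X := fun k => (1 / M : ℝ) • ∑ t, ((t k : ℤ) : ℝ) • f t with hv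
  set Q := ∑ ε, ‖ψ ε‖ ^ 2 with hQ
  have hQ0 : 0 ≤ Q := Finset.sum_nonneg fun _ _ => by positivity
  -- Since ψ is a Rademacher sum, pairing it with f sees only the first order Walsh coefficients v
  -- of f. The Lewis inequality and the bound R for the projection then give Q ≤ MNR√Q.
  have h1 : Q = M * ∑ k, x.coord k (v k) := by
    have : ∀ ε, ‖ψ ε‖ ^ 2 = ∑ k, ((ε k : ℤ) : ℝ) * x.coord k (f ε) := by
      intro ε
      rw [← hf2, hψ, signSum]
      simp
    simp only [hQ, this, hv, map_smul, map_sum, smul_eq_mul, Finset.mul_sum]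
    rw [Finset.sum_comm]
    refine Finset.sum_congr rfl fun k _ => Finset.sum_congr rfl fun ε _ => ?_
    field_simp
  have h2 : ‖signSumL2 κ X v‖ ≤ R * √Q := by
    refine le_of_sq_le_sq ?_ (by positivity)
    rw [norm_signSumL2_sq, mul_pow, Real.sq_sqrt hQ0]
    refine (hR f).trans (mul_le_mul_of_nonneg_left ?_ (by positivity))
    exact Finset.sum_le_sum fun ε _ => pow_le_pow_left₀ (norm_nonneg _) (hf1 ε) 2
  have h3 : Q ≤ M * N * R * √Q := by
    calc Q ≤ M * (N * (R * √Q)) := by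
          rw [h1]
          exact mul_le_mul_of_nonneg_left ((hx v).trans (mul_le_mul_of_nonneg_left
            (by rw [← h1]; exact h2) hN)) hMpos.le
      _ = _ := by ring
  have h4 : √Q ≤ M * N * R := by
    rcases eq_or_lt_of_le (Real.sqrt_nonneg Q) with h | h
    · rw [← h]; positivity
    · nth_rewrite 1 [← Real.mul_self_sqrt hQ0] at h3
      exact le_of_mul_le_mul_right h3 h
  calc Q = √Q ^ 2 := (Real.sq_sqrt hQ0).symm
    _ ≤ _ := pow_le_pow_left₀ (Real.sqrt_nonneg _) h4 2

/-- Multiplication by δ permutes the cube. -/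
theorem norm_signSumL2_sign_smul {κ X : Type*} [Fintype κ] [DecidableEq κ] [NormedAddCommGroup X]
    [NormedSpace ℝ X] (x : κ → X) (δ : κ → ℤˣ) :
    ‖signSumL2 κ X (fun k => ((δ k : ℤ) : ℝ) • x k)‖ = ‖signSumL2 κ X x‖ := by
  rw [← sq_eq_sq₀ (norm_nonneg _) (norm_nonneg _), norm_signSumL2_sq, norm_signSumL2_sq]
  rw [← Equiv.sum_comp (Equiv.mulRight δ) (fun ε => ‖signSum x ε‖ ^ 2)]
  refine Finset.sum_congr rfl fun ε _ => ?_
  simp [signSum, smul_smul]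

/-- The contraction principle for Rademacher averages. -/
theorem norm_signSumL2_smul_le {κ X : Type*} [Fintype κ] [DecidableEq κ] [NormedAddCommGroup X]
    [NormedSpace ℝ X] (x : κ → X) (z : κ → ℝ) (hz : ∀ k, |z k| ≤ 1) :
    ‖signSumL2 κ X (fun k => z k • x k)‖ ≤ ‖signSumL2 κ X x‖ := by
  set T : (κ → ℝ) →ₗ[ℝ] PiLp 2 (fun _ : κ → ℤˣ => X) :=
    signSumL2 κ X ∘ₗ LinearMap.pi fun k => (LinearMap.proj k).smulRight (x k) with hT
  have hTz : ∀ w : κ → ℝ, T w = signSumL2 κ X (fun k => w k • x k) := fun w => rfl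
  -- A convex function on the cube is dominated by its value at some vertex, and all vertices give
  -- the same norm.
  have hmem : z ∈ convexHull ℝ (Set.univ.pi fun _ : κ => ({-1, 1} : Set ℝ)) := by
    rw [convexHull_pi]
    intro k _
    simp only [convexHull_pair]
    rw [segment_eq_Icc (by norm_num)]
    exact abs_le.1 (hz k)
  have hconv : ConvexOn ℝ Set.univ fun w : κ → ℝ => ‖T w‖ :=
    convexOn_univ_norm.comp_linearMap T
  obtain ⟨v, hv, hle⟩ := hconv.exists_ge_of_mem_convexHull (Set.subset_univ _) hmem
  have hδ : ∀ k, ∃ u : ℤˣ, ((u : ℤ) : ℝ) = v k := by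
    intro k
    rcases hv k (Set.mem_univ k) with h | h
    · exact ⟨-1, by simp [h]⟩
    · exact ⟨1, by simp [Set.mem_singleton_iff.1 h]⟩
  choose δ hδ using hδ
  rw [← hTz]
  refine hle.trans ?_
  simp only [hTz, ← hδ]
  exact (norm_signSumL2_sign_smul x δ).le

/-! ### From Rademacher averages to volume -/

theorem EuclideanSpace.volume_abs_le_one (κ : Type*) [Fintype κ] :
    MeasureTheory.volume {z : EuclideanSpace ℝ κ | ∀ k, |z k| ≤ 1} = 2 ^ Fintype.card κ := by
  have h : {z : EuclideanSpace ℝ κ | ∀ k, |z k| ≤ 1}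
      = WithLp.ofLp ⁻¹' (Set.Icc (fun _ => -1) (fun _ => 1)) := by
    ext z
    simp [Set.mem_Icc, Pi.le_def, abs_le, forall_and]
  rw [h, (PiLp.volume_preserving_ofLp κ).measure_preimage
    measurableSet_Icc.nullMeasurableSet, Real.volume_Icc_pi]
  norm_num

/-- Coordinatewise sign changes, as a linear isometry of Euclidean space. -/
def signFlip {κ : Type*} [Fintype κ] (ε : κ → ℤˣ) :
    EuclideanSpace ℝ κ ≃ₗᵢ[ℝ] EuclideanSpace ℝ κ :=
  LinearIsometryEquiv.piLpCongrRight 2 fun k =>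
    if ε k = 1 then LinearIsometryEquiv.refl ℝ ℝ else LinearIsometryEquiv.neg ℝ

theorem signFlip_apply {κ : Type*} [Fintype κ] (ε : κ → ℤˣ) (z : EuclideanSpace ℝ κ) (k : κ) :
    signFlip ε z k = ((ε k : ℤ) : ℝ) * z k := by
  rcases Int.units_eq_one_or (ε k) with h | h <;> simp [signFlip, h]

/-- The cube is invariant under sign changes, so the integrand may be averaged over them; at each
point of the cube the contraction principle bounds that average by the one over the vertices. -/
theorem lintegral_cube_norm_sq_le {κ X : Type*} [Fintype κ] [DecidableEq κ]
    [NormedAddCommGroup X] [NormedSpace ℝ X] (T : EuclideanSpace ℝ κ →ₗ[ℝ] X) {a : ℝ}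
    (h : ∑ ε, ‖signSum (fun k => T (EuclideanSpace.single k 1)) ε‖ ^ 2
      ≤ 2 ^ Fintype.card κ * a ^ 2) :
    ∫⁻ z in {z : EuclideanSpace ℝ κ | ∀ k, |z k| ≤ 1}, ENNReal.ofReal (‖T z‖ ^ 2)
      ≤ 2 ^ Fintype.card κ * ENNReal.ofReal (a ^ 2) := by
  set C : Set (EuclideanSpace ℝ κ) := {z | ∀ k, |z k| ≤ 1} with hC
  have hTc : Continuous fun z => ENNReal.ofReal (‖T z‖ ^ 2) :=
    ENNReal.continuous_ofReal.comp ((T.continuous_of_finiteDimensional.norm).pow 2)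
  have hflip : ∀ ε : κ → ℤˣ, ∫⁻ z in C, ENNReal.ofReal (‖T (signFlip ε z)‖ ^ 2)
      = ∫⁻ z in C, ENNReal.ofReal (‖T z‖ ^ 2) := by
    intro ε
    have hpre : (signFlip ε) ⁻¹' C = C := by
      ext z
      have : ∀ u : ℤˣ, |((u : ℤ) : ℝ)| = 1 := by
        intro u; rcases Int.units_eq_one_or u with rfl | rfl <;> simp
      simp [hC, signFlip_apply, abs_mul, this]
    conv_lhs => rw [← hpre]
    exact (signFlip ε).measurePreserving.setLIntegral_comp_preimage_emb
      (signFlip ε).toHomeomorph.measurableEmbedding (fun z => ENNReal.ofReal (‖T z‖ ^ 2)) C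
  have hpt : ∀ z ∈ C, ∑ ε, ENNReal.ofReal (‖T (signFlip ε z)‖ ^ 2)
      ≤ ENNReal.ofReal (2 ^ Fintype.card κ * a ^ 2) := by
    intro z hz
    rw [← ENNReal.ofReal_sum_of_nonneg fun _ _ => by positivity]
    refine ENNReal.ofReal_le_ofReal (le_trans ?_ h)
    have h1 := norm_signSumL2_smul_le (fun k => T (EuclideanSpace.single k 1)) (fun k => z k) hz
    have h2 := pow_le_pow_left₀ (norm_nonneg _) h1 2
    rw [norm_signSumL2_sq, norm_signSumL2_sq] at h2
    refine le_of_eq_of_le (Finset.sum_congr rfl fun ε _ => ?_) h2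
    congr 2
    have : signFlip ε z = signSum (fun k => z k • EuclideanSpace.single k (1 : ℝ)) ε := by
      ext k
      simp [signSum, signFlip_apply, Finset.sum_apply, Pi.single_apply]
    rw [this, map_signSum]
    simp
  have hvol := EuclideanSpace.volume_abs_le_one κ
  have hcard : ∑ _ε : κ → ℤˣ, ∫⁻ z in C, ENNReal.ofReal (‖T z‖ ^ 2)
      = 2 ^ Fintype.card κ * ∫⁻ z in C, ENNReal.ofReal (‖T z‖ ^ 2) := by
    simp
  have hCm : MeasurableSet C := by
    refine IsClosed.measurableSet ?_
    simp only [hC, Set.ofPred_forall]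
    exact isClosed_iInter fun k => isClosed_le (by fun_prop) continuous_const
  have hfin : (2 : ℝ≥0∞) ^ Fintype.card κ ≠ ⊤ := by simp
  have h0 : (2 : ℝ≥0∞) ^ Fintype.card κ ≠ 0 := by simp
  refine (ENNReal.mul_le_mul_iff_right h0 hfin).1 ?_
  rw [← hcard, ← Finset.sum_congr rfl fun ε _ => hflip ε, ← MeasureTheory.lintegral_finsetSum]
  · calc _ ≤ ∫⁻ z in C, ENNReal.ofReal (2 ^ Fintype.card κ * a ^ 2) :=
          MeasureTheory.setLIntegral_mono' hCm hpt
      _ = _ := by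
          rw [MeasureTheory.setLIntegral_const, hvol, ENNReal.ofReal_mul (by positivity),
            ENNReal.ofReal_pow (by positivity)]
          simp only [ENNReal.ofReal_ofNat]
          ring
  · intro ε _
    exact (hTc.comp (signFlip ε).continuous).measurable

/-- A lower bound for the volume of a unit ball by the Rademacher average of a tuple. -/
theorem abs_det_le_volume_norm_le_one {κ X : Type*} [Fintype κ] [DecidableEq κ]
    [NormedAddCommGroup X] [NormedSpace ℝ X] (ι : EuclideanSpace ℝ κ →ₗ[ℝ] X)
    (x : κ → EuclideanSpace ℝ κ) {a : ℝ} (ha : 0 < a)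
    (h : ∑ ε, ‖ι (signSum x ε)‖ ^ 2 ≤ 2 ^ Fintype.card κ * a ^ 2) :
    ENNReal.ofReal |(EuclideanSpace.basisFun κ ℝ).toBasis.det x|
      ≤ 2 * ENNReal.ofReal (a ^ Fintype.card κ)
        * MeasureTheory.volume {z : EuclideanSpace ℝ κ | ‖ι z‖ ≤ 1} := by
  set b := (EuclideanSpace.basisFun κ ℝ).toBasis with hb
  set T : EuclideanSpace ℝ κ →ₗ[ℝ] EuclideanSpace ℝ κ := b.constr ℝ x with hT
  have hTb : ∀ k, T (EuclideanSpace.single k 1) = x k := by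
    intro k
    have := b.constr_basis ℝ x k
    rwa [hb, OrthonormalBasis.coe_toBasis, EuclideanSpace.basisFun_apply] at this
  have hdet : LinearMap.det T = b.det x := by
    have := b.det_comp T b
    rw [b.det_self, mul_one] at this
    rw [← this]
    congr 1
    ext1 k
    simp [hT]
  set C : Set (EuclideanSpace ℝ κ) := {z | ∀ k, |z k| ≤ 1} with hC
  have hvol : MeasureTheory.volume C = _ := EuclideanSpace.volume_abs_le_one κ
  have hint := lintegral_cube_norm_sq_le (ι ∘ₗ T) (a := a) (by
    simpa [hTb, map_signSum] using h)
  have hc : Continuous fun z => ‖ι (T z)‖ :=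
    ((ι ∘ₗ T).continuous_of_finiteDimensional).norm
  set B : Set (EuclideanSpace ℝ κ) := {z | 2 * a ≤ ‖ι (T z)‖} with hB
  have hBm : MeasurableSet B := (isClosed_le continuous_const hc).measurableSet
  have hmarkov := MeasureTheory.mul_meas_ge_le_lintegral
    (μ := MeasureTheory.volume.restrict C)
    (f := fun z => ENNReal.ofReal (‖ι (T z)‖ ^ 2))
    (ENNReal.continuous_ofReal.comp (hc.pow 2) :
      Continuous fun z => ENNReal.ofReal (‖ι (T z)‖ ^ 2)).measurable (ENNReal.ofReal ((2 * a) ^ 2))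
  have hBset : {z : EuclideanSpace ℝ κ | ENNReal.ofReal ((2 * a) ^ 2)
      ≤ ENNReal.ofReal (‖ι (T z)‖ ^ 2)} = B := by
    ext z
    simp only [hB, Set.mem_ofPred_eq]
    rw [ENNReal.ofReal_le_ofReal_iff (by positivity),
      sq_le_sq₀ (by positivity) (norm_nonneg _)]
  rw [hBset, MeasureTheory.Measure.restrict_apply hBm] at hmarkov
  -- Markov's inequality at twice the root mean square `a`: the bad set fills at most a quarter of
  -- the cube, so at least half of the cube is good.
  have hbad : 4 * MeasureTheory.volume (B ∩ C) ≤ 2 ^ Fintype.card κ := by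
    have h1 := hmarkov.trans hint
    have h2 : ENNReal.ofReal ((2 * a) ^ 2) = ENNReal.ofReal (a ^ 2) * 4 := by
      rw [mul_pow, mul_comm, ENNReal.ofReal_mul (by positivity)]
      norm_num
    rw [h2, mul_assoc, mul_comm (2 ^ _) (ENNReal.ofReal _)] at h1
    exact (ENNReal.mul_le_mul_iff_right (by simpa using ha.ne') ENNReal.ofReal_ne_top).1 h1
  have hgood : 2 ^ Fintype.card κ ≤ 2 * MeasureTheory.volume (C \ B) := by
    have h1 : MeasureTheory.volume C ≤ MeasureTheory.volume (B ∩ C)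
        + MeasureTheory.volume (C \ B) := by
      refine (MeasureTheory.measure_mono ?_).trans (MeasureTheory.measure_union_le _ _)
      intro z hz
      by_cases hzB : z ∈ B
      · exact Or.inl ⟨hzB, hz⟩
      · exact Or.inr ⟨hz, hzB⟩
    rw [hvol] at h1
    have hfin : MeasureTheory.volume (B ∩ C) ≠ ⊤ := fun h => by
      rw [h] at hbad; simp at hbad
    have hfin' : MeasureTheory.volume (C \ B) ≠ ⊤ := fun h => by
      have := MeasureTheory.measure_mono (μ := MeasureTheory.volume)
        (Set.sdiff_subset : C \ B ⊆ C)
      rw [h, hvol] at this; simp at this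
    have hfin2 : (2 : ℝ≥0∞) ^ Fintype.card κ ≠ ⊤ := by simp
    lift MeasureTheory.volume (B ∩ C) to ℝ≥0 using hfin with u
    lift MeasureTheory.volume (C \ B) to ℝ≥0 using hfin' with w
    lift (2 : ℝ≥0∞) ^ Fintype.card κ to ℝ≥0 using hfin2 with m
    norm_cast at *
    have e1 : (4 : ℝ) * u ≤ m := by exact_mod_cast hbad
    have e2 : (m : ℝ) ≤ u + w := by exact_mod_cast h1
    have : (m : ℝ) ≤ 2 * w := by
      have : (0 : ℝ) ≤ m := m.2
      linarith
    exact_mod_cast this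
  -- The good part is mapped into 2a times the unit ball. On comparing volumes, the 2^(card κ) from
  -- the dilation cancels against the volume of the cube.
  have himg : T '' (C \ B) ⊆ (2 * a) • {z : EuclideanSpace ℝ κ | ‖ι z‖ ≤ 1} := by
    rintro _ ⟨z, ⟨-, hz⟩, rfl⟩
    rw [Set.mem_smul_set_iff_inv_smul_mem₀ (by positivity)]
    simp only [hB, Set.mem_ofPred_eq, not_le] at hz
    simp only [Set.mem_ofPred_eq, map_smul, norm_smul, norm_inv, Real.norm_eq_abs,
      abs_of_pos (show 0 < 2 * a by positivity)]
    rw [inv_mul_le_iff₀ (by positivity)]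
    linarith
  have hm := MeasureTheory.measure_mono (μ := MeasureTheory.volume) himg
  rw [MeasureTheory.Measure.addHaar_image_linearMap, MeasureTheory.Measure.addHaar_smul, hdet,
    finrank_euclideanSpace, mul_pow, abs_mul, ENNReal.ofReal_mul (by positivity),
    abs_of_pos (show 0 < a ^ Fintype.card κ by positivity)] at hm
  have h2 : ENNReal.ofReal |(2 : ℝ) ^ Fintype.card κ| = 2 ^ Fintype.card κ := by
    rw [abs_of_pos (by positivity), ENNReal.ofReal_pow (by positivity)]; simp
  rw [h2] at hm
  refine (ENNReal.mul_le_mul_iff_right (a := 2 ^ Fintype.card κ) (by simp) (by simp)).1 ?_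
  calc 2 ^ Fintype.card κ * ENNReal.ofReal |b.det x|
      ≤ 2 * MeasureTheory.volume (C \ B) * ENNReal.ofReal |b.det x| := by gcongr
    _ = 2 * (ENNReal.ofReal |b.det x| * MeasureTheory.volume (C \ B)) := by ring
    _ ≤ _ := mul_le_mul_of_nonneg_left hm zero_le_two
    _ = _ := by ring

/-! ### Linear symplectic maps and transvections -/

/-- The standard symplectic form as a bilinear map. -/
def stdSymplecticBilin (n : ℕ) : PhaseSpace n →ₗ[ℝ] PhaseSpace n →ₗ[ℝ] ℝ :=
  LinearMap.mk₂ ℝ stdSymplecticForm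
    (fun u u' v => by
      simp only [stdSymplecticForm, PiLp.add_apply, ← Finset.sum_add_distrib]
      exact Finset.sum_congr rfl fun _ _ => by ring)
    (fun c u v => by
      simp only [stdSymplecticForm, PiLp.smul_apply, smul_eq_mul, Finset.mul_sum]
      exact Finset.sum_congr rfl fun _ _ => by ring)
    (fun u v v' => by
      simp only [stdSymplecticForm, PiLp.add_apply, ← Finset.sum_add_distrib]
      exact Finset.sum_congr rfl fun _ _ => by ring)
    (fun c u v => by
      simp only [stdSymplecticForm, PiLp.smul_apply, smul_eq_mul, Finset.mul_sum]
      exact Finset.sum_congr rfl fun _ _ => by ring)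

theorem stdSymplecticBilin_apply {n : ℕ} (u v : PhaseSpace n) :
    stdSymplecticBilin n u v = stdSymplecticForm u v := rfl

theorem stdSymplecticBilin_swap {n : ℕ} (u v : PhaseSpace n) :
    stdSymplecticBilin n u v = - stdSymplecticBilin n v u := by
  simp only [stdSymplecticBilin_apply, stdSymplecticForm, ← Finset.sum_neg_distrib]
  exact Finset.sum_congr rfl fun _ _ => by ring

theorem stdSymplecticBilin_self {n : ℕ} (u : PhaseSpace n) : stdSymplecticBilin n u u = 0 := by
  have := stdSymplecticBilin_swap u u
  linarith

theorem exists_stdSymplecticBilin_eq {n : ℕ} (f : PhaseSpace n →ₗ[ℝ] ℝ) :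
    ∃ b, stdSymplecticBilin n b = f := by
  refine ⟨WithLp.toLp 2 (Sum.elim (fun j => f (EuclideanSpace.single (Sum.inr j) 1))
    (fun j => - f (EuclideanSpace.single (Sum.inl j) 1))), ?_⟩
  refine (EuclideanSpace.basisFun (Fin n ⊕ Fin n) ℝ).toBasis.ext fun k => ?_
  rw [OrthonormalBasis.coe_toBasis, EuclideanSpace.basisFun_apply]
  rcases k with k | k <;>
    simp [stdSymplecticBilin_apply, stdSymplecticForm]

/-- The symplectic transvection `z ↦ z + c ω(w, z) w`. -/
def symplecticTransvection {n : ℕ} (c : ℝ) (w : PhaseSpace n) :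
    PhaseSpace n ≃ₗ[ℝ] PhaseSpace n :=
  LinearEquiv.ofLinearMap
    (LinearMap.id + (c • stdSymplecticBilin n w).smulRight w)
    (LinearMap.id + ((-c) • stdSymplecticBilin n w).smulRight w)
    (by ext1 z; simp [stdSymplecticBilin_self])
    (by ext1 z; simp [stdSymplecticBilin_self])

theorem symplecticTransvection_apply {n : ℕ} (c : ℝ) (w z : PhaseSpace n) :
    symplecticTransvection c w z = z + (c * stdSymplecticBilin n w z) • w := rfl

theorem isLinearSymplectic_symplecticTransvection {n : ℕ} (c : ℝ) (w : PhaseSpace n) :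
    IsLinearSymplectic (symplecticTransvection c w) := by
  intro u v
  simp only [← stdSymplecticBilin_apply, symplecticTransvection_apply, map_add, map_smul,
    LinearMap.add_apply, LinearMap.smul_apply, stdSymplecticBilin_self, smul_eq_mul]
  rw [stdSymplecticBilin_swap u w]
  ring

theorem IsLinearSymplectic.trans {n : ℕ} {φ ψ : PhaseSpace n ≃ₗ[ℝ] PhaseSpace n}
    (hφ : IsLinearSymplectic φ) (hψ : IsLinearSymplectic ψ) :
    IsLinearSymplectic (φ.trans ψ) := fun u v => by
  simp [hψ (φ u) (φ v), hφ u v]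

theorem IsLinearSymplectic.symm {n : ℕ} {φ : PhaseSpace n ≃ₗ[ℝ] PhaseSpace n}
    (hφ : IsLinearSymplectic φ) : IsLinearSymplectic φ.symm := fun u v => by
  rw [← hφ]; simp

/-- Two vectors with non-zero symplectic product are exchanged by a transvection that fixes every
vector with equal products with both of them. -/
theorem exists_symplectic_map_of_ne_zero {n : ℕ} {u u' : PhaseSpace n}
    (h : stdSymplecticBilin n u' u ≠ 0) :
    ∃ ψ : PhaseSpace n ≃ₗ[ℝ] PhaseSpace n, IsLinearSymplectic ψ ∧ ψ u = u' ∧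
      ∀ z, stdSymplecticBilin n u z = stdSymplecticBilin n u' z → ψ z = z := by
  refine ⟨symplecticTransvection (stdSymplecticBilin n u' u)⁻¹ (u' - u),
    isLinearSymplectic_symplecticTransvection _ _, ?_, fun z hz => ?_⟩
  · simp [symplecticTransvection_apply, stdSymplecticBilin_self, h]
  · simp [symplecticTransvection_apply, hz]

/-- One transvection fails when the two vectors are ω-orthogonal, so the route passes through a z
that is orthogonal to neither. -/
theorem exists_symplectic_map_eq {n : ℕ} {u u' : PhaseSpace n} (hu : u ≠ 0) (hu' : u' ≠ 0) :
    ∃ ψ : PhaseSpace n ≃ₗ[ℝ] PhaseSpace n, IsLinearSymplectic ψ ∧ ψ u = u' := by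
  have hex : ∀ v : PhaseSpace n, v ≠ 0 → ∃ z, stdSymplecticBilin n z v ≠ 0 := by
    intro v hv
    obtain ⟨b, hb⟩ := exists_stdSymplecticBilin_eq (innerSL ℝ v).toLinearMap
    refine ⟨b, ?_⟩
    rw [hb]
    simpa using hv
  have hz : ∃ z, stdSymplecticBilin n z u ≠ 0 ∧ stdSymplecticBilin n z u' ≠ 0 := by
    obtain ⟨z, hz⟩ := hex u hu
    obtain ⟨z', hz'⟩ := hex u' hu'
    by_cases h1 : stdSymplecticBilin n z u' = 0
    · by_cases h2 : stdSymplecticBilin n z' u = 0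
      · exact ⟨z + z', by simpa [h2] using hz, by simpa [h1] using hz'⟩
      · exact ⟨z', h2, hz'⟩
    · exact ⟨z, hz, h1⟩
  obtain ⟨z, hz, hz'⟩ := hz
  obtain ⟨φ, hφ, h1, -⟩ := exists_symplectic_map_of_ne_zero hz
  obtain ⟨ψ, hψ, h2, -⟩ := exists_symplectic_map_of_ne_zero (u := z) (u' := u')
    (by rw [stdSymplecticBilin_swap]; simpa using hz')
  exact ⟨φ.trans ψ, hφ.trans hψ, by simp [h1, h2]⟩

/-- The linear symplectic group acts transitively on pairs with symplectic product one. -/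
theorem exists_symplectic_map_pair {n : ℕ} {u v u' v' : PhaseSpace n}
    (h : stdSymplecticBilin n u v = 1) (h' : stdSymplecticBilin n u' v' = 1) :
    ∃ ψ : PhaseSpace n ≃ₗ[ℝ] PhaseSpace n, IsLinearSymplectic ψ ∧ ψ u = u' ∧ ψ v = v' := by
  have hne : ∀ a b : PhaseSpace n, stdSymplecticBilin n a b = 1 → a ≠ 0 := by
    rintro a b hab rfl
    simp at hab
  obtain ⟨φ, hφ, h1⟩ := exists_symplectic_map_eq (hne u v h) (hne u' v' h')
  have hv : stdSymplecticBilin n u' (φ v) = 1 := by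
    rw [← h1, stdSymplecticBilin_apply, hφ, ← stdSymplecticBilin_apply, h]
  -- The second vector must be moved while u' stays fixed. All vectors used here have product 1 with
  -- u', so transvections along their differences fix u'. If φ v and v' are ω-orthogonal, φ v + u'
  -- serves as an intermediate stop.
  obtain ⟨ψ, hψ, h2, h3⟩ : ∃ ψ : PhaseSpace n ≃ₗ[ℝ] PhaseSpace n,
      IsLinearSymplectic ψ ∧ ψ u' = u' ∧ ψ (φ v) = v' := by
    have hs : ∀ a b : PhaseSpace n, stdSymplecticBilin n u' a = 1 → stdSymplecticBilin n u' b = 1 →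
        stdSymplecticBilin n a u' = stdSymplecticBilin n b u' := by
      intro a b ha hb
      rw [stdSymplecticBilin_swap a, stdSymplecticBilin_swap b, ha, hb]
    by_cases h0 : stdSymplecticBilin n v' (φ v) = 0
    · have hz : stdSymplecticBilin n u' (φ v + u') = 1 := by
        simp [hv, stdSymplecticBilin_self]
      obtain ⟨ψ₁, hψ₁, e1, e2⟩ := exists_symplectic_map_of_ne_zero (u := φ v) (u' := φ v + u')
        (by simp [stdSymplecticBilin_self, hv])
      obtain ⟨ψ₂, hψ₂, e3, e4⟩ := exists_symplectic_map_of_ne_zero (u := φ v + u') (u' := v')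
        (by rw [map_add, h0, stdSymplecticBilin_swap, h']; norm_num)
      refine ⟨ψ₁.trans ψ₂, hψ₁.trans hψ₂, ?_, by simp [e1, e3]⟩
      simp [e2 u' (hs _ _ hv hz), e4 u' (hs _ _ hz h')]
    · obtain ⟨ψ, hψ, e1, e2⟩ := exists_symplectic_map_of_ne_zero h0
      exact ⟨ψ, hψ, e2 u' (hs _ _ hv h'), e1⟩
  exact ⟨φ.trans ψ, hφ.trans hψ, by simp [h1, h2], by simp [h3]⟩

/-- A pair with symplectic product one gives the first two coordinates of a linear symplectic
map. -/
theorem exists_symplectic_coordinates {n : ℕ} [NeZero n] {a b : PhaseSpace n}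
    (h : stdSymplecticBilin n a b = 1) :
    ∃ ψ : PhaseSpace n ≃ₗ[ℝ] PhaseSpace n, IsLinearSymplectic ψ ∧ ∀ z,
      ψ z (Sum.inl 0) = - stdSymplecticBilin n b z ∧
      ψ z (Sum.inr 0) = stdSymplecticBilin n a z := by
  have h1 : ∀ z : PhaseSpace n,
      stdSymplecticBilin n (EuclideanSpace.single (Sum.inl 0) 1) z = z (Sum.inr 0) := by
    intro z
    simp [stdSymplecticBilin_apply, stdSymplecticForm]
  have h2 : ∀ z : PhaseSpace n,
      stdSymplecticBilin n (EuclideanSpace.single (Sum.inr 0) 1) z = - z (Sum.inl 0) := by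
    intro z
    simp [stdSymplecticBilin_apply, stdSymplecticForm]
  obtain ⟨ψ, hψ, ha, hb⟩ := exists_symplectic_map_pair h
    (u' := EuclideanSpace.single (Sum.inl 0) 1) (v' := EuclideanSpace.single (Sum.inr 0) 1)
    (by simp [h1])
  refine ⟨ψ, hψ, fun z => ⟨?_, ?_⟩⟩
  · rw [← neg_eq_iff_eq_neg, ← h2, ← hb]
    exact hψ b z
  · rw [← h1, ← ha]
    exact hψ a z

/-- Biorthogonal tuples with respect to the symplectic form have inverse determinants. -/
theorem abs_det_mul_abs_det_eq_one {n : ℕ} (x y : Fin n ⊕ Fin n → PhaseSpace n)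
    (h : ∀ i j, stdSymplecticBilin n (y i) (x j) = if i = j then 1 else 0) :
    |(EuclideanSpace.basisFun (Fin n ⊕ Fin n) ℝ).toBasis.det x| *
      |(EuclideanSpace.basisFun (Fin n ⊕ Fin n) ℝ).toBasis.det y| = 1 := by
  set b := (EuclideanSpace.basisFun (Fin n ⊕ Fin n) ℝ).toBasis with hb
  have hrepr : ∀ (z : Fin n ⊕ Fin n → PhaseSpace n) i j, b.toMatrix z i j = z j i := by
    intro z i j
    simp [hb, Module.Basis.toMatrix_apply]
  -- The sign is −1 because `Matrix.J` represents −ω in these coordinates.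
  have hmat : (b.toMatrix y).transpose * Matrix.J (Fin n) ℝ * b.toMatrix x = -1 := by
    ext i j
    rw [Matrix.neg_apply, Matrix.one_apply, ← h, stdSymplecticBilin_apply]
    simp [Matrix.mul_apply, hrepr, Matrix.J, stdSymplecticForm,
      Matrix.one_apply, Finset.sum_sub_distrib]
    ring
  have hd := congrArg (fun A => |Matrix.det A|) hmat
  have hJ : |(Matrix.J (Fin n) ℝ).det| = 1 := by
    have := Matrix.J_det_mul_J_det (Fin n) ℝ
    rcases mul_self_eq_one_iff.1 this with h | h <;> simp [h]
  have h1 : |(-1 : Matrix (Fin n ⊕ Fin n) (Fin n ⊕ Fin n) ℝ).det| = 1 := by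
    rw [Matrix.det_neg]; simp
  simp only [Matrix.det_mul, Matrix.det_transpose, abs_mul, hJ, h1, mul_one] at hd
  rw [b.det_apply, b.det_apply, mul_comm]
  exact hd

/-- The projection fixes Rademacher sums, and a nonzero one exists. -/
theorem one_le_of_sum_norm_rademacher_le {κ X : Type*} [Fintype κ] [DecidableEq κ] [Nonempty κ]
    [NormedAddCommGroup X] [NormedSpace ℝ X] [Nontrivial X] {R : ℝ} (hR0 : 0 ≤ R)
    (hR : ∀ f : (κ → ℤˣ) → X, ∑ ε, ‖signSum (fun k => (1 / 2 ^ Fintype.card κ : ℝ) •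
      ∑ t, ((t k : ℤ) : ℝ) • f t) ε‖ ^ 2 ≤ R ^ 2 * ∑ ε, ‖f ε‖ ^ 2) : 1 ≤ R := by
  obtain ⟨v, hv⟩ := exists_ne (0 : X)
  have h := hR (signSum fun _ => v)
  simp only [sum_sign_smul_signSum, smul_smul] at h
  rw [one_div_mul_cancel (by positivity)] at h
  simp only [one_smul] at h
  have hpos : 0 < ∑ ε : κ → ℤˣ, ‖signSum (fun _ => v) ε‖ ^ 2 := by
    rw [← norm_signSumL2_sq]
    have : (fun _ : κ => v) ≠ 0 := fun h => hv (congrFun h (Classical.arbitrary κ))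
    have := norm_pos_iff.2 fun h => this (signSumL2_injective κ X (by simpa using h))
    positivity
  have : 1 ≤ R ^ 2 := by
    by_contra hc
    nlinarith
  nlinarith

/-! ### The symplectic form on the dual space and the volume of the unit ball -/

/-- The norm of the functional `ω(a, ·)`. -/
def symplecticDualNorm {n : ℕ} {X : Type*} [NormedAddCommGroup X] [NormedSpace ℝ X]
    [FiniteDimensional ℝ X] (ι : PhaseSpace n ≃ₗ[ℝ] X) (a : PhaseSpace n) : ℝ :=
  ‖LinearMap.toContinuousLinearMap (stdSymplecticBilin n a ∘ₗ ι.symm.toLinearMap)‖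

theorem symplecticDualNorm_nonneg {n : ℕ} {X : Type*} [NormedAddCommGroup X] [NormedSpace ℝ X]
    [FiniteDimensional ℝ X] (ι : PhaseSpace n ≃ₗ[ℝ] X) (a : PhaseSpace n) :
    0 ≤ symplecticDualNorm ι a := norm_nonneg _

theorem abs_stdSymplecticBilin_le {n : ℕ} {X : Type*} [NormedAddCommGroup X] [NormedSpace ℝ X]
    [FiniteDimensional ℝ X] (ι : PhaseSpace n ≃ₗ[ℝ] X) (a z : PhaseSpace n) :
    |stdSymplecticBilin n a z| ≤ symplecticDualNorm ι a * ‖ι z‖ := by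
  have := (LinearMap.toContinuousLinearMap
    (stdSymplecticBilin n a ∘ₗ ι.symm.toLinearMap)).le_opNorm (ι z)
  simpa [symplecticDualNorm] using this

theorem symplecticDualNorm_smul {n : ℕ} {X : Type*} [NormedAddCommGroup X] [NormedSpace ℝ X]
    [FiniteDimensional ℝ X] (ι : PhaseSpace n ≃ₗ[ℝ] X) (c : ℝ) (a : PhaseSpace n) :
    symplecticDualNorm ι (c • a) = |c| * symplecticDualNorm ι a := by
  rw [symplecticDualNorm, map_smul, LinearMap.smul_comp, map_smul, norm_smul, Real.norm_eq_abs,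
    symplecticDualNorm]

/-- By Hahn–Banach, ‖ι a‖ is the value at a of a functional of norm at most 1. Nondegeneracy writes
it as ω(b, ·), and the bound on ω applies to the pair (b, a). -/
theorem norm_le_mul_symplecticDualNorm {n : ℕ} {X : Type*} [NormedAddCommGroup X]
    [NormedSpace ℝ X] [FiniteDimensional ℝ X] (ι : PhaseSpace n ≃ₗ[ℝ] X) {s : ℝ} (hs : 0 ≤ s)
    (h : ∀ a b, stdSymplecticBilin n a b ≤ s * symplecticDualNorm ι a * symplecticDualNorm ι b)
    (a : PhaseSpace n) : ‖ι a‖ ≤ s * symplecticDualNorm ι a := by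
  obtain ⟨g, hg1, hg2⟩ := exists_dual_vector'' ℝ (ι a)
  obtain ⟨b, hb⟩ := exists_stdSymplecticBilin_eq (g.toLinearMap ∘ₗ ι.toLinearMap)
  have hbn : symplecticDualNorm ι b ≤ 1 := by
    rw [symplecticDualNorm, hb]
    refine le_of_eq_of_le ?_ hg1
    congr 1
    ext z
    simp
  have h1 : ‖ι a‖ = stdSymplecticBilin n b a := by
    rw [hb]; simpa using hg2.symm
  rw [h1]
  refine (h b a).trans ?_
  refine mul_le_mul_of_nonneg_right ?_ (symplecticDualNorm_nonneg ι a)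
  exact mul_le_of_le_one_right hs hbn

open MeasureTheory in
/-- If the symplectic form is bounded by `s` on the polar body, then the unit ball has large
volume. -/
theorem one_le_volume_sq_of_stdSymplecticBilin_le {n : ℕ} [NeZero n] {X : Type*}
    [NormedAddCommGroup X] [NormedSpace ℝ X] [FiniteDimensional ℝ X] (ι : PhaseSpace n ≃ₗ[ℝ] X)
    {R s : ℝ} (hR0 : 0 ≤ R) (hs : 0 < s)
    (hR : ∀ f : (Fin n ⊕ Fin n → ℤˣ) → X, ∑ ε, ‖signSum (fun k =>
      (1 / 2 ^ Fintype.card (Fin n ⊕ Fin n) : ℝ) • ∑ t, ((t k : ℤ) : ℝ) • f t) ε‖ ^ 2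
        ≤ R ^ 2 * ∑ ε, ‖f ε‖ ^ 2)
    (h : ∀ a b, stdSymplecticBilin n a b ≤ s * symplecticDualNorm ι a * symplecticDualNorm ι b) :
    1 ≤ 4 * ENNReal.ofReal ((s * (2 * n) * R) ^ (2 * n)) *
      volume {z : PhaseSpace n | ‖ι z‖ ≤ 1} ^ 2 := by
  set κ := Fin n ⊕ Fin n
  have hn : 0 < n := Nat.pos_of_ne_zero (NeZero.ne n)
  have : Nonempty κ := ⟨Sum.inl ⟨0, hn⟩⟩
  have hcard : Fintype.card κ = 2 * n := by simp [κ, two_mul]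
  set e := EuclideanSpace.basisFun κ ℝ with he
  have : Nontrivial X := ι.symm.toEquiv.nontrivial
  have hR1 : 1 ≤ R := one_le_of_sum_norm_rademacher_le hR0 hR
  obtain ⟨x, hx1, hx2⟩ := exists_basis_sum_coord_le (e.toBasis.map ι) (signSumL2 κ X)
    (signSumL2_injective κ X)
  have hdual := sum_norm_signSum_coord_sq_le x hR0 (Nat.cast_nonneg _) hx2 hR
  choose y hy using fun k => exists_stdSymplecticBilin_eq (x.coord k ∘ₗ ι.toLinearMap)
  have hprod := abs_det_mul_abs_det_eq_one (fun k => ι.symm (x k)) y fun i j => by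
    rw [hy]; simp [Finsupp.single_apply, eq_comm]
  set M : ℝ := 2 ^ Fintype.card κ with hM
  have hM0 : 0 < M := by positivity
  have hsq : √M ^ 2 = M := Real.sq_sqrt hM0.le
  -- The norm of `signSumL2` is not normalized, so norm at most 1 means root mean square at most
  -- 1/√M. The dual tuple below carries √M instead, and the two factors cancel in the product.
  have hV1 := abs_det_le_volume_norm_le_one ι.toLinearMap (fun k => ι.symm (x k))
    (a := 1 / √M) (by positivity) (by
      have h1 := pow_le_pow_left₀ (norm_nonneg _) hx1 2
      rw [norm_signSumL2_sq, one_pow] at h1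
      rw [div_pow, hsq, one_pow, mul_one_div_cancel hM0.ne']
      simpa [map_signSum] using h1)
  have hV2 := abs_det_le_volume_norm_le_one ι.toLinearMap y
    (a := s * (2 * n) * R * √M) (by positivity) (by
      have h1 : ∀ ε : κ → ℤˣ, ‖ι (signSum y ε)‖ ^ 2 ≤ s ^ 2 *
          ‖signSum (fun k => LinearMap.toContinuousLinearMap (x.coord k)) ε‖ ^ 2 := by
        intro ε
        rw [← mul_pow]
        refine pow_le_pow_left₀ (norm_nonneg _) ?_ 2
        refine (norm_le_mul_symplecticDualNorm ι hs.le h _).trans (le_of_eq ?_)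
        rw [symplecticDualNorm]
        congr 2
        ext z
        simp [hy, signSum]
      calc _ ≤ ∑ ε : κ → ℤˣ, s ^ 2 *
            ‖signSum (fun k => LinearMap.toContinuousLinearMap (x.coord k)) ε‖ ^ 2 :=
            Finset.sum_le_sum fun ε _ => h1 ε
        _ ≤ s ^ 2 * (M * (Fintype.card κ : ℝ) * R) ^ 2 := by
            rw [← Finset.mul_sum]
            exact mul_le_mul_of_nonneg_left hdual (by positivity)
        _ = _ := by
            rw [← hM, mul_pow _ (√M), hsq, hcard]
            push_cast
            ring)
  have hmul := mul_le_mul' hV1 hV2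
  rw [← ENNReal.ofReal_mul (abs_nonneg _), hprod, ENNReal.ofReal_one] at hmul
  refine hmul.trans (le_of_eq ?_)
  have hof : ENNReal.ofReal ((s * (2 * n) * R) ^ (2 * n))
      = ENNReal.ofReal ((1 / √M) ^ Fintype.card κ)
        * ENNReal.ofReal ((s * (2 * n) * R * √M) ^ Fintype.card κ) := by
    rw [← ENNReal.ofReal_mul (by positivity), ← mul_pow, hcard]
    congr 2
    field_simp
  rw [hof]
  simp only [LinearEquiv.coe_coe]
  ring

/-! ### A Rogers–Shephard inequality -/

open MeasureTheory in
/-- A form of the Rogers-Shephard inequality. -/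
theorem measure_half_smul_sub_self_le {E : Type*} [NormedAddCommGroup E] [NormedSpace ℝ E]
    [FiniteDimensional ℝ E] [MeasurableSpace E] [BorelSpace E] (μ : Measure E)
    [μ.IsAddHaarMeasure] {K : Set E} (hc : IsCompact K) (hK : Convex ℝ K) (h0 : μ K ≠ 0) :
    μ ((2⁻¹ : ℝ) • (K - K)) ≤ 2 ^ Module.finrank ℝ E * μ K := by
  have hfin : μ K ≠ ⊤ := hc.measure_ne_top
  have hm := hc.measurableSet
  -- The shear (x, y) ↦ (x, y − x) preserves the product measure, so μ(K)² is the integral over y of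
  -- μ(K ∩ (y + K)). For y = (k − l)/2 this section contains ½k + ½K.
  have hpre := (measurePreserving_prod_sub μ μ).measure_preimage
    (hm.prod hm.neg).nullMeasurableSet
  rw [Measure.prod_prod, Measure.measure_neg, Measure.prod_apply_symm
    ((measurePreserving_prod_sub μ μ).measurable (hm.prod hm.neg))] at hpre
  have hsec : ∀ y ∈ (2⁻¹ : ℝ) • (K - K), ENNReal.ofReal (2⁻¹ ^ Module.finrank ℝ E) * μ K
      ≤ μ ((fun x => (x, y)) ⁻¹' ((fun z : E × E => (z.1, z.2 - z.1)) ⁻¹' (K ×ˢ (-K)))) := by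
    rintro _ ⟨_, ⟨k, hk, l, hl, rfl⟩, rfl⟩
    have h1 : μ ((2⁻¹ : ℝ) • k +ᵥ (2⁻¹ : ℝ) • K)
        = ENNReal.ofReal (2⁻¹ ^ Module.finrank ℝ E) * μ K := by
      rw [measure_vadd, Measure.addHaar_smul, abs_of_pos (by positivity)]
    rw [← h1]
    refine measure_mono ?_
    rintro _ ⟨_, ⟨w, hw, rfl⟩, rfl⟩
    refine ⟨hK hk hw (by norm_num) (by norm_num) (by norm_num), ?_⟩
    have h2 : (2⁻¹ : ℝ) • l + (2⁻¹ : ℝ) • w ∈ K :=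
      hK hl hw (by norm_num) (by norm_num) (by norm_num)
    rw [Set.mem_neg]
    convert! h2 using 1
    simp only [vadd_eq_add, smul_sub]
    abel
  have hS : MeasurableSet ((2⁻¹ : ℝ) • (K - K)) := by
    rw [sub_eq_add_neg]
    exact ((hc.add hc.neg).smul _).measurableSet
  have h3 : ENNReal.ofReal (2⁻¹ ^ Module.finrank ℝ E) * μ K * μ ((2⁻¹ : ℝ) • (K - K))
      ≤ μ K * μ K := by
    rw [← hpre, ← setLIntegral_const]
    exact (setLIntegral_mono' hS hsec).trans (setLIntegral_le_lintegral _ _)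
  have h4 : (2 : ℝ≥0∞) ^ Module.finrank ℝ E * ENNReal.ofReal (2⁻¹ ^ Module.finrank ℝ E) = 1 := by
    have : (2 : ℝ≥0∞) ^ Module.finrank ℝ E = ENNReal.ofReal (2 ^ Module.finrank ℝ E) := by
      rw [ENNReal.ofReal_pow (by norm_num)]; simp
    rw [this, ← ENNReal.ofReal_mul (by positivity), ← mul_pow]
    norm_num
  refine (ENNReal.mul_le_mul_iff_right h0 hfin).1 ?_
  calc μ K * μ ((2⁻¹ : ℝ) • (K - K))
      = 2 ^ Module.finrank ℝ E * (ENNReal.ofReal (2⁻¹ ^ Module.finrank ℝ E) * μ K *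
          μ ((2⁻¹ : ℝ) • (K - K))) := by
        rw [← mul_assoc, ← mul_assoc, h4, one_mul]
    _ ≤ 2 ^ Module.finrank ℝ E * (μ K * μ K) := by gcongr
    _ = _ := by ring

/-! ### Extracting a real bound from the K-convexity constant -/

theorem cubeL2Norm_rademacherProj_le {X : Type*} [NormedAddCommGroup X] [NormedSpace ℝ X]
    (h : radConst X ≠ ⊤) {m : ℕ} (f : (Fin m → ℤˣ) → X) :
    cubeL2Norm (rademacherProj f) ≤ (radConst X).toReal * cubeL2Norm f := by
  have hb : 0 ≤ cubeL2Norm f := Real.sqrt_nonneg _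
  refine le_of_forall_pos_le_add fun η hη => ?_
  -- The infimum defining the operator norm is only approached, so an admissible C within δ is used;
  -- the +1 avoids division by zero.
  set δ := η / (cubeL2Norm f + 1) with hδ
  have hδ0 : 0 < δ := by positivity
  have hlt : rademacherProjNorm X m < radConst X + ENNReal.ofReal δ :=
    (le_iSup (rademacherProjNorm X) m).trans_lt
      (ENNReal.lt_add_right h (by simpa using hδ0))
  rw [rademacherProjNorm] at hlt
  obtain ⟨C, hlt⟩ := iInf_lt_iff.1 hlt
  obtain ⟨hC, hlt⟩ := iInf_lt_iff.1 hlt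
  have hCle : (C : ℝ) ≤ (radConst X).toReal + δ := by
    have := ENNReal.toReal_mono (by finiteness) hlt.le
    rwa [ENNReal.toReal_add h (by finiteness), ENNReal.toReal_ofReal hδ0.le] at this
  have h1 : δ * cubeL2Norm f ≤ η := by
    rw [hδ, div_mul_eq_mul_div, div_le_iff₀ (by positivity)]
    nlinarith
  nlinarith [hC f, mul_le_mul_of_nonneg_right hCle hb]

theorem sum_norm_signSum_le_of_cubeL2Norm_le {κ X : Type*} [Fintype κ] [DecidableEq κ]
    [NormedAddCommGroup X] [NormedSpace ℝ X] {m : ℕ} (e : κ ≃ Fin m) {R : ℝ}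
    (hR : ∀ f : (Fin m → ℤˣ) → X, cubeL2Norm (rademacherProj f) ≤ R * cubeL2Norm f)
    (f : (κ → ℤˣ) → X) :
    ∑ ε, ‖signSum (fun k => (1 / 2 ^ Fintype.card κ : ℝ) •
      ∑ t, ((t k : ℤ) : ℝ) • f t) ε‖ ^ 2 ≤ R ^ 2 * ∑ ε, ‖f ε‖ ^ 2 := by
  have hcard : Fintype.card κ = m := by simpa using Fintype.card_congr e
  set q : (κ → ℤˣ) ≃ (Fin m → ℤˣ) := e.arrowCongr (Equiv.refl _) with hq
  have hqa : ∀ ε k, q ε (e k) = ε k := by intro ε k; simp [hq]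
  have h := pow_le_pow_left₀ (Real.sqrt_nonneg _) (hR (f ∘ q.symm)) 2
  simp only [cubeL2Norm] at h
  rw [mul_pow, Real.sq_sqrt (by positivity), Real.sq_sqrt (by positivity),
    ← Equiv.sum_comp q, ← Equiv.sum_comp q (fun t => ‖(f ∘ q.symm) t‖ ^ 2)] at h
  have hcoeff : ∀ k, rademacherCoeff (f ∘ q.symm) (e k)
      = (1 / 2 ^ Fintype.card κ : ℝ) • ∑ t, ((t k : ℤ) : ℝ) • f t := by
    intro k
    rw [rademacherCoeff, ← Equiv.sum_comp q, hcard]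
    simp [rademacher, hqa]
  have hproj : ∀ ε, rademacherProj (f ∘ q.symm) (q ε)
      = signSum (fun k => (1 / 2 ^ Fintype.card κ : ℝ) • ∑ t, ((t k : ℤ) : ℝ) • f t) ε := by
    intro ε
    rw [rademacherProj, ← Equiv.sum_comp e, signSum]
    refine Finset.sum_congr rfl fun k _ => ?_
    rw [hcoeff, rademacher, hqa]
  simp only [hproj, Function.comp_apply, Equiv.symm_apply_apply] at h
  have hpos : (0 : ℝ) < 1 / 2 ^ m := by positivity
  rw [mul_left_comm] at h
  exact le_of_mul_le_mul_left h hpos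

/-! ### Embedding into a cylinder -/

open MeasureTheory in
theorem linCylindricalCapacity_le {n : ℕ} [NeZero n] {X : Type*}
    [NormedAddCommGroup X] [NormedSpace ℝ X] [FiniteDimensional ℝ X] (ι : PhaseSpace n ≃ₗ[ℝ] X)
    {R s : ℝ} (hR0 : 0 ≤ R) (hs : 0 < s)
    (hR : ∀ f : (Fin n ⊕ Fin n → ℤˣ) → X, ∑ ε, ‖signSum (fun k =>
      (1 / 2 ^ Fintype.card (Fin n ⊕ Fin n) : ℝ) • ∑ t, ((t k : ℤ) : ℝ) • f t) ε‖ ^ 2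
        ≤ R ^ 2 * ∑ ε, ‖f ε‖ ^ 2)
    (h : 4 * ENNReal.ofReal ((s * (2 * n) * R) ^ (2 * n)) *
      volume {z : PhaseSpace n | ‖ι z‖ ≤ 1} ^ 2 < 1)
    {K : Set (PhaseSpace n)} (hK : ∀ z ∈ K, ‖ι z‖ ≤ 2) :
    linCylindricalCapacity K ≤ ENNReal.ofReal (Real.pi * (8 / s)) := by
  obtain ⟨a, b, hab⟩ : ∃ a b, s * symplecticDualNorm ι a * symplecticDualNorm ι b
      < stdSymplecticBilin n a b := by
    by_contra! hc
    exact absurd (one_le_volume_sq_of_stdSymplecticBilin_le ι hR0 hs hR hc) (not_le.2 h)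
  set α := symplecticDualNorm ι a with hα
  set β := symplecticDualNorm ι b with hβ
  set w := stdSymplecticBilin n a b with hw
  have hα0 : 0 ≤ α := symplecticDualNorm_nonneg ι a
  have hβ0 : 0 ≤ β := symplecticDualNorm_nonneg ι b
  have hw0 : 0 < w := lt_of_le_of_lt (by positivity) hab
  have hαpos : 0 < α := by
    refine hα0.lt_of_ne' fun h0 => ?_
    have := (le_abs_self _).trans (abs_stdSymplecticBilin_le ι a b)
    rw [← hα, h0, zero_mul] at this
    linarith
  have hβpos : 0 < β := by
    refine hβ0.lt_of_ne' fun h0 => ?_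
    have := (neg_le_abs _).trans (abs_stdSymplecticBilin_le ι b a)
    rw [← hβ, h0, zero_mul, ← stdSymplecticBilin_swap] at this
    linarith
  -- The scaling makes the symplectic product 1 and balances the dual norms: (cα)² = (dβ)² = αβ/w <
  -- 1/s.
  set c := √(β / (α * w)) with hc
  set d := √(α / (β * w)) with hd
  have hc2 : c ^ 2 = β / (α * w) := Real.sq_sqrt (by positivity)
  have hd2 : d ^ 2 = α / (β * w) := Real.sq_sqrt (by positivity)
  have hcd : c * d = 1 / w := by
    rw [hc, hd, ← Real.sqrt_mul (by positivity),
      show β / (α * w) * (α / (β * w)) = (1 / w) ^ 2 by field_simp,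
      Real.sqrt_sq (by positivity)]
  have hpair : stdSymplecticBilin n (c • a) (d • b) = 1 := by
    simp only [map_smul, LinearMap.smul_apply, smul_eq_mul, ← hw]
    rw [← mul_assoc, mul_comm d c, hcd]
    field_simp
  obtain ⟨ψ, hψ, hcoord⟩ := exists_symplectic_coordinates hpair
  have hbound : α * β / w < 1 / s := by
    rw [div_lt_div_iff₀ hw0 hs]
    linarith
  have hr : 0 < √(8 / s) := Real.sqrt_pos.2 (by positivity)
  -- Each of the two coordinates has square at most 2²·αβ/w on K, whence the 8.
  have hsub : ψ '' K ⊆ symplecticCylinder n √(8 / s) := by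
    rintro _ ⟨z, hz, rfl⟩
    have hz2 := hK z hz
    have key : ∀ (t : ℝ) (u : PhaseSpace n), stdSymplecticBilin n (t • u) z ^ 2
        ≤ 4 * (t ^ 2 * symplecticDualNorm ι u ^ 2) := by
      intro t u
      have h1 := abs_stdSymplecticBilin_le ι (t • u) z
      rw [symplecticDualNorm_smul] at h1
      have h2 : |stdSymplecticBilin n (t • u) z| ≤ |t| * symplecticDualNorm ι u * 2 :=
        h1.trans (mul_le_mul_of_nonneg_left hz2
          (mul_nonneg (abs_nonneg _) (symplecticDualNorm_nonneg ι u)))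
      have h3 := pow_le_pow_left₀ (abs_nonneg _) h2 2
      rw [sq_abs, mul_pow, mul_pow, sq_abs] at h3
      linarith
    have ka := key c a
    have kb := key d b
    rw [hc2, ← hα, show β / (α * w) * α ^ 2 = α * β / w by field_simp] at ka
    rw [hd2, ← hβ, show α / (β * w) * β ^ 2 = α * β / w by field_simp] at kb
    change ψ z (Sum.inl 0) ^ 2 + ψ z (Sum.inr 0) ^ 2 < √(8 / s) ^ 2
    rw [(hcoord z).1, (hcoord z).2, neg_sq, Real.sq_sqrt (by positivity),
      show 8 / s = 8 * (1 / s) by ring]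
    linarith
  refine iInf_le_of_le √(8 / s) <| iInf_le_of_le hr <| iInf_le_of_le ψ <|
    iInf_le_of_le hψ <| iInf_le_of_le hsub ?_
  rw [Real.sq_sqrt (by positivity)]

/-! ### The normed space of a convex body -/

namespace BodySpace

variable {n : ℕ} {K : Set (PhaseSpace n)} (hK : IsConvexBody K)

/-- The identity map from phase space to the normed space of a convex body. -/
def equiv : PhaseSpace n ≃ₗ[ℝ] BodySpace hK := LinearEquiv.refl ℝ (PhaseSpace n)

instance instFiniteDimensional : FiniteDimensional ℝ (BodySpace hK) :=
  (equiv hK).finiteDimensional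

theorem norm_equiv (z : PhaseSpace n) : ‖equiv hK z‖ = gauge (symmetrization K) z := rfl

theorem norm_equiv_le_two (h0 : (0 : PhaseSpace n) ∈ K) {z : PhaseSpace n} (hz : z ∈ K) :
    ‖equiv hK z‖ ≤ 2 := by
  rw [norm_equiv]
  refine gauge_le_of_mem zero_le_two ?_
  rw [symmetrization, smul_smul]
  norm_num
  exact ⟨z, hz, 0, h0, sub_zero z⟩

-- Rogers–Shephard is applied to the compact closure of K, which has the same volume because the
-- boundary of a convex set is null.
open MeasureTheory in
theorem volume_norm_equiv_le_one_le :
    volume {z : PhaseSpace n | ‖equiv hK z‖ ≤ 1} ≤ 4 ^ n * volume K := by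
  have hcl : volume (closure K) = volume K :=
    measure_congr (closure_ae_eq_of_null_frontier (hK.convex.addHaar_frontier _))
  have hpos : volume K ≠ 0 :=
    ((isOpen_interior.measure_pos _ hK.interior_nonempty).trans_le
      (measure_mono interior_subset)).ne'
  have hcomp : IsCompact (closure K) := hK.bounded.isCompact_closure
  have h := measure_half_smul_sub_self_le volume hcomp hK.convex.closure (by rwa [hcl])
  have hfr : Module.finrank ℝ (PhaseSpace n) = 2 * n := by
    simp [finrank_euclideanSpace, two_mul]
  rw [hcl, hfr, pow_mul, show (2 : ℝ≥0∞) ^ 2 = 4 by norm_num] at h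
  refine (measure_mono ?_).trans h
  intro z hz
  have hz' : z ∈ closure (symmetrization K) :=
    (gauge_le_one_iff_mem_closure hK.symmetrization_convex hK.symmetrization_mem_nhds).1 hz
  have hclosed : IsClosed ((2⁻¹ : ℝ) • (closure K - closure K)) := by
    rw [sub_eq_add_neg]
    exact ((hcomp.add hcomp.neg).smul _).isClosed
  refine closure_minimal ?_ hclosed hz'
  exact Set.smul_set_mono (Set.sub_subset_sub subset_closure subset_closure)

end BodySpace

/-! ### Constants and conclusion -/

open MeasureTheory in
theorem volume_ball_phaseSpace (n : ℕ) [NeZero n] :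
    volume (Metric.ball (0 : PhaseSpace n) 1) = ENNReal.ofReal (Real.pi ^ n / n.factorial) := by
  have hfr : Module.finrank ℝ (PhaseSpace n) = 2 * n := by
    simp [finrank_euclideanSpace, two_mul]
  have : Nontrivial (PhaseSpace n) := Module.nontrivial_of_finrank_pos (R := ℝ) (by
    rw [hfr]; have := NeZero.pos n; omega)
  rw [InnerProductSpace.volume_ball_of_dim_even hfr]
  simp

/-- The numerical estimate that fixes the constant. -/
theorem four_mul_pow_mul_sq_lt_one {n : ℕ} (hn : n ≠ 0) {R ρ k v : ℝ} (hR : 1 ≤ R) (hρ : 0 < ρ)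
    (hρn : ρ ^ n = k / (Real.pi ^ n / n.factorial)) (hk : 0 < k) (hv0 : 0 ≤ v)
    (hv : v ≤ 4 ^ n * k) :
    4 * (8 / (256 * Real.pi * Real.exp 1 * R ^ 2 * ρ) * (2 * n) * R) ^ (2 * n) * v ^ 2 < 1 := by
  have hπ := Real.pi_pos
  have he := Real.exp_pos 1
  have hR0 : 0 < R := one_pos.trans_le hR
  set q := 8 / (256 * Real.pi * Real.exp 1 * R ^ 2 * ρ) * (2 * n) * R with hq
  have hq0 : 0 ≤ q := by positivity
  -- One of the two powers of R in s cancels; the other is discarded using R ≥ 1.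
  have hqle : q ≤ n / (16 * Real.pi * Real.exp 1 * ρ) := by
    have : q = n / (16 * Real.pi * Real.exp 1 * ρ) / R := by
      rw [hq]; field_simp; norm_num
    rw [this]
    exact div_le_self (by positivity) hR
  have hstir : (n : ℝ) ^ n ≤ Real.exp 1 ^ n * n.factorial := by
    have h := Real.pow_div_factorial_le_exp (n : ℝ) (Nat.cast_nonneg n) n
    rw [div_le_iff₀ (by positivity)] at h
    rwa [← Real.exp_nat_mul, mul_one]
  have h4 : (4 : ℝ) ≤ 4 ^ n := le_self_pow₀ (by norm_num) hn
  -- Of 16^n = 4^n·4^n, one factor absorbs the Rogers–Shephard loss and the other leaves at most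
  -- 1/4, since n ≥ 1.
  have hqv : q ^ n * v ≤ 1 / 4 := by
    calc q ^ n * v ≤ (n / (16 * Real.pi * Real.exp 1 * ρ)) ^ n * (4 ^ n * k) :=
          mul_le_mul (pow_le_pow_left₀ hq0 hqle n) hv hv0 (by positivity)
      _ = (n : ℝ) ^ n / (Real.exp 1 ^ n * n.factorial) / 4 ^ n := by
          rw [div_pow, mul_pow _ ρ, hρn, mul_pow, mul_pow,
            show (16 : ℝ) ^ n = 4 ^ n * 4 ^ n by rw [← mul_pow]; norm_num]
          field_simp
      _ ≤ 1 / 4 ^ n := by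
          gcongr
          exact div_le_one_of_le₀ hstir (by positivity)
      _ ≤ 1 / 4 := by gcongr
  calc 4 * q ^ (2 * n) * v ^ 2 = 4 * (q ^ n * v) ^ 2 := by ring
    _ ≤ 4 * (1 / 4) ^ 2 := by gcongr
    _ < 1 := by norm_num

open MeasureTheory in
theorem linCylindricalCapacity_div_pi_le {n : ℕ} [NeZero n] {K : Set (PhaseSpace n)}
    (hK : IsConvexBody K) (h0 : (0 : PhaseSpace n) ∈ K) :
    linCylindricalCapacity K / ENNReal.ofReal Real.pi
      ≤ ENNReal.ofReal (256 * Real.pi * Real.exp 1) * radConst (BodySpace hK) ^ 2 *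
        (volume K / volume (Metric.ball (0 : PhaseSpace n) 1)) ^ (1 / (n : ℝ)) := by
  have hn : n ≠ 0 := NeZero.ne n
  have hn0 : (0 : ℝ) < n := by exact_mod_cast NeZero.pos n
  have hπ := Real.pi_pos
  have hvolK : volume K ≠ 0 :=
    ((isOpen_interior.measure_pos _ hK.interior_nonempty).trans_le
      (measure_mono interior_subset)).ne'
  have hvolK' : volume K ≠ ⊤ := hK.bounded.measure_lt_top.ne
  set β := Real.pi ^ n / n.factorial with hβ
  have hβ0 : 0 < β := by positivity
  set k := (volume K).toReal with hk
  have hk0 : 0 < k := ENNReal.toReal_pos hvolK hvolK'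
  have hkK : volume K = ENNReal.ofReal k := (ENNReal.ofReal_toReal hvolK').symm
  set ρ := (k / β) ^ (1 / (n : ℝ)) with hρ
  have hρ0 : 0 < ρ := by positivity
  have hρn : ρ ^ n = k / β := by
    rw [hρ, ← Real.rpow_natCast, ← Real.rpow_mul (by positivity), one_div_mul_cancel hn0.ne',
      Real.rpow_one]
  have hratio : (volume K / volume (Metric.ball (0 : PhaseSpace n) 1)) ^ (1 / (n : ℝ))
      = ENNReal.ofReal ρ := by
    rw [volume_ball_phaseSpace, hkK, ← ENNReal.ofReal_div_of_pos hβ0,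
      ENNReal.ofReal_rpow_of_pos (by positivity)]
  rw [hratio]
  -- If the constant is infinite the right side is ∞, the other factors being positive.
  rcases eq_or_ne (radConst (BodySpace hK)) ⊤ with htop | htop
  · rw [htop, ENNReal.top_pow two_ne_zero, ENNReal.mul_top (by simp; positivity),
      ENNReal.top_mul (by simpa using hρ0)]
    exact le_top
  set R := (radConst (BodySpace hK)).toReal with hR
  have hRX : radConst (BodySpace hK) = ENNReal.ofReal R := (ENNReal.ofReal_toReal htop).symm
  have hR0 : 0 ≤ R := ENNReal.toReal_nonneg
  have hRad := sum_norm_signSum_le_of_cubeL2Norm_le (X := BodySpace hK)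
    (finSumFinEquiv (m := n) (n := n)) (fun f => cubeL2Norm_rademacherProj_le htop f)
  have : Nonempty (Fin n ⊕ Fin n) := ⟨Sum.inl 0⟩
  have : Nontrivial (BodySpace hK) := (BodySpace.equiv hK).symm.toEquiv.nontrivial
  have hR1 : 1 ≤ R := one_le_of_sum_norm_rademacher_le hR0 hRad
  have hR1' : 0 < R := one_pos.trans_le hR1
  -- Chosen so that 8/s is exactly the claimed bound.
  set s := 8 / (256 * Real.pi * Real.exp 1 * R ^ 2 * ρ) with hs
  have hs0 : 0 < s := by positivity
  have hV := BodySpace.volume_norm_equiv_le_one_le hK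
  have hVfin : volume {z : PhaseSpace n | ‖BodySpace.equiv hK z‖ ≤ 1} ≠ ⊤ :=
    (hV.trans_lt (by finiteness)).ne
  set v := (volume {z : PhaseSpace n | ‖BodySpace.equiv hK z‖ ≤ 1}).toReal with hv
  have hvle : v ≤ 4 ^ n * k := by
    have := ENNReal.toReal_mono (by finiteness) hV
    simpa [ENNReal.toReal_mul] using this
  have hlt := four_mul_pow_mul_sq_lt_one hn hR1 hρ0 hρn hk0 ENNReal.toReal_nonneg hvle
  have hcap := linCylindricalCapacity_le (BodySpace.equiv hK) hR0 hs0 hRad (by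
    rw [← ENNReal.ofReal_toReal hVfin, ← hv, ← ENNReal.ofReal_pow ENNReal.toReal_nonneg,
      show (4 : ℝ≥0∞) = ENNReal.ofReal 4 by simp, ← ENNReal.ofReal_mul (by norm_num),
      ← ENNReal.ofReal_mul (by positivity), ENNReal.ofReal_lt_one]
    exact hlt) (fun z hz => BodySpace.norm_equiv_le_two hK h0 hz)
  refine ENNReal.div_le_of_le_mul (hcap.trans (le_of_eq ?_))
  rw [hRX, ← ENNReal.ofReal_pow hR0, ← ENNReal.ofReal_mul (by positivity),
    ← ENNReal.ofReal_mul (by positivity), ← ENNReal.ofReal_mul (by positivity)]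
  congr 1
  rw [hs]
  field_simp

end

theorem mainTheorem2 :
    ∃ A₂ : ℝ, 0 < A₂ ∧ ∀ (n : ℕ) [NeZero n] (K : Set (PhaseSpace n)) (hK : IsConvexBody K),
      (0 : PhaseSpace n) ∈ interior K →
        linCylindricalCapacity K / ENNReal.ofReal Real.pi
            ≤ ENNReal.ofReal A₂ * radConst (BodySpace hK) ^ 2 *
              (MeasureTheory.volume K /
                MeasureTheory.volume (Metric.ball (0 : PhaseSpace n) 1)) ^ (1 / (n : ℝ)) ∧
        ∀ c : Set (PhaseSpace n) → ℝ≥0∞, IsSymplecticCapacity c →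
          linCylindricalCapacity K / c (Metric.ball (0 : PhaseSpace n) 1)
            ≤ ENNReal.ofReal A₂ * radConst (BodySpace hK) ^ 2 *
              (MeasureTheory.volume K /
                MeasureTheory.volume (Metric.ball (0 : PhaseSpace n) 1)) ^ (1 / (n : ℝ)) := by
  refine ⟨256 * Real.pi * Real.exp 1, by positivity, fun n _ K hK h0 => ?_⟩
  have h := linCylindricalCapacity_div_pi_le hK (interior_subset h0)
  refine ⟨h, fun c hc => ?_⟩
  rwa [hc.ball 1 one_pos, one_pow, mul_one]
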